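/- Let $n\ge 1$, let $J=\begin{pmatrix}0&I\\-I&0\end{pmatrix}$ and $\omega(u,v)=\langle u,Jv\rangle$ on $\mathbb{R}^{2n}$, and let $X\subset\mathbb{R}^{2n}$ be a bounded convex domain with $C^\infty$ boundary that is strongly convex, i.e. the second fundamental form of $\partial X$ is positive definite at every boundary point. Let $N_z$ be the outer unit normal at $z\in\partial X$. The symplectic billiard map sends a pair $(x,y)$ in the phase space $$\{(x,y)\in\partial X\times\partial X:\ \omega(N_x,N_y)\neq 0\}$$ to the pair $(y,z)$, where $z\in\partial X$, $z\ne x$, is the unique boundary point such that the line $xz$ is parallel to the characteristic direction $JN_y$. Then the set of $3$-periodic points of this map, the set of its $4$-periodic points, and the union of these two sets all have empty interior in the phase space. -/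

import Mathlib

namespace SymplecticBilliard

open Set Filter Topology
open scoped ContDiff

/-- The standard symplectic space `ℝ²ⁿ = ℝⁿ × ℝⁿ` with its Euclidean structure. -/
abbrev SympSpace (n : ℕ) : Type := EuclideanSpace ℝ (Fin n ⊕ Fin n)

/-- The matrix `J = (0 I; -I 0)`, as a linear map of `ℝ²ⁿ`. -/
noncomputable def stdJ (n : ℕ) : SympSpace n →ₗ[ℝ] SympSpace n :=
  Matrix.toEuclideanLin (Matrix.fromBlocks 0 1 (-1) 0)

/-- The standard symplectic form `ω(u, v) = ⟪u, J v⟫`, that is `∑ dqᵢ ∧ dpᵢ`. -/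
noncomputable def sympForm {n : ℕ} (u v : SympSpace n) : ℝ := inner ℝ u (stdJ n v)

/-- A bounded convex domain with `C^∞` boundary whose second fundamental form is positive definite
at every boundary point. Near a boundary point `z` the domain is `{ρ < 0}` for a smooth `ρ` with
`dρ(z) ≠ 0`; the tangent space of the boundary at `z` is `ker dρ(z)`, on which the second
fundamental form with respect to the outer normal is, up to the positive factor `1 / ‖∇ρ(z)‖`, the
Hessian of `ρ`. -/
structure IsStronglyConvexDomain {n : ℕ} (X : Set (SympSpace n)) : Prop where
  isOpen : IsOpen X
  nonempty : X.Nonempty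
  isBounded : Bornology.IsBounded X
  convex : Convex ℝ X
  boundary : ∀ z ∈ frontier X, ∃ (U : Set (SympSpace n)) (ρ : SympSpace n → ℝ),
    IsOpen U ∧ z ∈ U ∧ ContDiffOn ℝ ∞ ρ U ∧ X ∩ U = {w | w ∈ U ∧ ρ w < 0} ∧
    fderiv ℝ ρ z ≠ 0 ∧
    ∀ v : SympSpace n, v ≠ 0 → fderiv ℝ ρ z v = 0 → 0 < fderiv ℝ (fderiv ℝ ρ) z v v

/-- `N` is an outer unit normal of the convex set `X` at `z`. -/
def IsOuterUnitNormal {n : ℕ} (X : Set (SympSpace n)) (z N : SympSpace n) : Prop :=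
  ‖N‖ = 1 ∧ ∀ w ∈ X, inner ℝ N (w - z) ≤ 0

lemma IsStronglyConvexDomain.fderiv_eq {n : ℕ} {X : Set (SympSpace n)}
    {z N : SympSpace n} (hN : IsOuterUnitNormal X z N)
    {U : Set (SympSpace n)} {ρ : SympSpace n → ℝ} (hU : IsOpen U) (hzU : z ∈ U)
    (hρ : DifferentiableAt ℝ ρ z) (hρz : ρ z = 0) (hXU : X ∩ U = {w | w ∈ U ∧ ρ w < 0})
    (hd : fderiv ℝ ρ z ≠ 0) :
    (∀ v, fderiv ℝ ρ z v = ‖fderiv ℝ ρ z‖ * inner ℝ N v) ∧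
    ∀ v, inner ℝ N v < 0 → ∀ᶠ t : ℝ in 𝓝[>] 0, z + t • v ∈ X := by
  have key : ∀ v, fderiv ℝ ρ z v < 0 → ∀ᶠ t : ℝ in 𝓝[>] 0, z + t • v ∈ X := by
    intro v hv
    have hline : HasDerivAt (fun t : ℝ => z + t • v) v 0 := by
      simpa using ((hasDerivAt_id (0 : ℝ)).smul_const v).const_add z
    have hf : HasDerivAt (fun t : ℝ => ρ (z + t • v)) (fderiv ℝ ρ z v) 0 := by
      have h1 : HasFDerivAt ρ (fderiv ℝ ρ z) (z + (0 : ℝ) • v) := by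
        simpa using hρ.hasFDerivAt
      exact h1.comp_hasDerivAt (0 : ℝ) hline
    have hs := (hf.hasDerivWithinAt (s := Ioi 0)).limsup_slope_le' (by simp) hv
    have hUt : ∀ᶠ t : ℝ in 𝓝[>] 0, z + t • v ∈ U := by
      apply nhdsWithin_le_nhds
      apply hline.continuousAt.eventually_mem
      simpa using hU.mem_nhds hzU
    filter_upwards [hs, hUt, self_mem_nhdsWithin] with t ht htU ht0
    have ht0' : (0 : ℝ) < t := ht0
    have : z + t • v ∈ X ∩ U := by
      rw [hXU]
      refine ⟨htU, ?_⟩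
      simp only [slope_def_field, zero_smul, add_zero, hρz, sub_zero] at ht
      by_contra hcon
      exact absurd ht (not_lt.mpr (div_nonneg (not_lt.mp hcon) ht0'.le))
    exact this.1
  have key2 : ∀ v, fderiv ℝ ρ z v < 0 → inner ℝ N v ≤ 0 := by
    intro v hv
    obtain ⟨t, ht, ht0⟩ := ((key v hv).and self_mem_nhdsWithin).exists
    have := hN.2 _ ht
    rw [add_sub_cancel_left, inner_smul_right] at this
    have ht0' : (0 : ℝ) < t := ht0
    by_contra hcon
    have := mul_pos ht0' (not_le.mp hcon)
    linarith
  set g := (InnerProductSpace.toDual ℝ (SympSpace n)).symm (fderiv ℝ ρ z) with hg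
  have hgi : ∀ v, fderiv ℝ ρ z v = inner ℝ g v := by
    intro v
    rw [hg, InnerProductSpace.toDual_symm_apply]
  have hgn : ‖g‖ = ‖fderiv ℝ ρ z‖ := by rw [hg, LinearIsometryEquiv.norm_map]
  have hg0 : 0 < ‖g‖ := by rw [hgn]; exact norm_pos_iff.mpr hd
  set c := inner ℝ N g / ‖g‖ ^ 2 with hc
  set m := N - c • g with hm
  have hgm : inner ℝ g m = 0 := by
    rw [hm, inner_sub_right, inner_smul_right, real_inner_self_eq_norm_sq, hc,
      div_mul_cancel₀ _ (by positivity), real_inner_comm, sub_self]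
  have hNm : inner ℝ N m = ‖m‖ ^ 2 := by
    have : N = m + c • g := by rw [hm]; abel
    rw [this, inner_add_left, inner_smul_left, hgm, real_inner_self_eq_norm_sq]
    simp
  have hm0 : m = 0 := by
    by_contra hne
    have hmp : 0 < ‖m‖ := norm_pos_iff.mpr hne
    have hpos : 0 < 2 * (|inner ℝ N g| + 1) := by positivity
    set ε := ‖m‖ ^ 2 / (2 * (|inner ℝ N g| + 1)) with hε
    have hεp : 0 < ε := by positivity
    have h1 := key2 (m - ε • g) (by
      rw [hgi, inner_sub_right, hgm, inner_smul_right, real_inner_self_eq_norm_sq]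
      have : 0 < ε * ‖g‖ ^ 2 := by positivity
      linarith)
    rw [inner_sub_right, hNm, inner_smul_right] at h1
    have h2 : ε * (2 * (|inner ℝ N g| + 1)) = ‖m‖ ^ 2 := by
      rw [hε]; field_simp
    have h3 : ε * inner ℝ N g ≤ ε * |inner ℝ N g| :=
      mul_le_mul_of_nonneg_left (le_abs_self _) hεp.le
    have h4 := abs_nonneg (inner ℝ N g)
    nlinarith [mul_nonneg hεp.le h4]
  have hNg : N = c • g := by rw [← sub_eq_zero]; exact hm0
  have hc0 : 0 ≤ c := by
    have h1 := key2 (-g) (by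
      rw [hgi, inner_neg_right, real_inner_self_eq_norm_sq]
      have : 0 < ‖g‖ ^ 2 := by positivity
      linarith)
    rw [inner_neg_right] at h1
    rw [hc]
    apply div_nonneg _ (by positivity)
    linarith
  have hcg : c * ‖g‖ = 1 := by
    have := hN.1
    rw [hNg, norm_smul, Real.norm_of_nonneg hc0] at this
    exact this
  have main : ∀ v, fderiv ℝ ρ z v = ‖fderiv ℝ ρ z‖ * inner ℝ N v := by
    intro v
    rw [hgi, ← hgn]
    conv_rhs => rw [hNg, inner_smul_left]
    simp only [conj_trivial]
    rw [← mul_assoc, mul_comm ‖g‖, hcg, one_mul]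
  refine ⟨main, fun v hv => key v ?_⟩
  rw [main]
  exact mul_neg_of_pos_of_neg (norm_pos_iff.mpr hd) hv

lemma IsStronglyConvexDomain.defining {n : ℕ} {X : Set (SympSpace n)}
    (hX : IsStronglyConvexDomain X) {z : SympSpace n} (hz : z ∈ frontier X)
    {U : Set (SympSpace n)} {ρ : SympSpace n → ℝ} (hU : IsOpen U)
    (hρ : ContinuousOn ρ U) (hXU : X ∩ U = {w | w ∈ U ∧ ρ w < 0}) :
    (∀ w ∈ closure X, w ∈ U → ρ w ≤ 0) ∧ (∀ w ∉ X, w ∈ U → 0 ≤ ρ w) ∧ (z ∈ U → ρ z = 0) := by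
  have h1 : ∀ w ∈ closure X, w ∈ U → ρ w ≤ 0 := by
    intro w hw hwU
    by_contra hcon
    have hev : ∀ᶠ u in 𝓝 w, 0 < ρ u ∧ u ∈ U :=
      ((hρ.continuousAt (hU.mem_nhds hwU)).eventually_const_lt (not_le.mp hcon)).and
        (hU.mem_nhds hwU)
    obtain ⟨u, huX, hu⟩ := ((mem_closure_iff_frequently.mp hw).and_eventually hev).exists
    have : u ∈ X ∩ U := ⟨huX, hu.2⟩
    rw [hXU] at this
    exact absurd this.2 (not_lt.mpr hu.1.le)
  have h2 : ∀ w ∉ X, w ∈ U → 0 ≤ ρ w := by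
    intro w hw hwU
    by_contra hcon
    have : w ∈ X ∩ U := by rw [hXU]; exact ⟨hwU, not_le.mp hcon⟩
    exact hw this.1
  refine ⟨h1, h2, fun hzU => le_antisymm (h1 z hz.1 hzU) (h2 z ?_ hzU)⟩
  have := hz.2
  rwa [hX.isOpen.interior_eq] at this

/-- The outer unit normal is well defined at every boundary point. -/
lemma IsStronglyConvexDomain.existsUnique_normal {n : ℕ} {X : Set (SympSpace n)}
    (hX : IsStronglyConvexDomain X) {z : SympSpace n} (hz : z ∈ frontier X) :
    ∃! N, IsOuterUnitNormal X z N := by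
  have hzX : z ∉ X := by
    have := hz.2
    rwa [hX.isOpen.interior_eq] at this
  obtain ⟨U, ρ, hU, hzU, hρ, hXU, hd, -⟩ := hX.boundary z hz
  have hρz := (hX.defining hz hU hρ.continuousOn hXU).2.2 hzU
  have hdiff : DifferentiableAt ℝ ρ z :=
    (hρ.contDiffAt (hU.mem_nhds hzU)).differentiableAt (by simp)
  obtain ⟨f, hf⟩ := geometric_hahn_banach_open_point hX.convex hX.isOpen hzX
  set m := (InnerProductSpace.toDual ℝ (SympSpace n)).symm f with hm
  have hmi : ∀ v, f v = inner ℝ m v := by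
    intro v
    rw [hm, InnerProductSpace.toDual_symm_apply]
  have hm0 : m ≠ 0 := by
    intro h
    obtain ⟨w, hw⟩ := hX.nonempty
    have := hf w hw
    rw [hmi, hmi, h] at this
    simp at this
  refine ⟨(‖m‖⁻¹ : ℝ) • m, ⟨?_, ?_⟩, ?_⟩
  · rw [norm_smul, norm_inv, norm_norm, inv_mul_cancel₀ (norm_ne_zero_iff.mpr hm0)]
  · intro w hw
    have := hf w hw
    rw [hmi, hmi] at this
    rw [inner_smul_left, inner_sub_right]
    simp only [conj_trivial]
    exact mul_nonpos_of_nonneg_of_nonpos (by positivity) (by linarith)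
  · have huniq : ∀ N N', IsOuterUnitNormal X z N → IsOuterUnitNormal X z N' → N = N' := by
      intro N N' hN hN'
      have h1 := (fderiv_eq hN hU hzU hdiff hρz hXU hd).1
      have h2 := (fderiv_eq hN' hU hzU hdiff hρz hXU hd).1
      apply ext_inner_right ℝ
      intro v
      have := (h1 v).symm.trans (h2 v)
      exact mul_left_cancel₀ (norm_ne_zero_iff.mpr hd) this
    intro N hN
    refine huniq _ _ hN ⟨?_, ?_⟩
    · rw [norm_smul, norm_inv, norm_norm, inv_mul_cancel₀ (norm_ne_zero_iff.mpr hm0)]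
    · intro w hw
      have := hf w hw
      rw [hmi, hmi] at this
      rw [inner_smul_left, inner_sub_right]
      simp only [conj_trivial]
      exact mul_nonpos_of_nonneg_of_nonpos (by positivity) (by linarith)

open Classical in
/-- The outer unit normal `N_z` at a boundary point `z` (and `0` where there is none). -/
noncomputable def outerNormal {n : ℕ} (X : Set (SympSpace n)) (z : SympSpace n) : SympSpace n :=
  if h : ∃ N, IsOuterUnitNormal X z N then h.choose else 0

/-- The characteristic direction `J N_z` at a boundary point `z`. -/
noncomputable def charDir {n : ℕ} (X : Set (SympSpace n)) (z : SympSpace n) : SympSpace n :=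
  stdJ n (outerNormal X z)

lemma IsStronglyConvexDomain.outerNormal_spec {n : ℕ} {X : Set (SympSpace n)}
    (hX : IsStronglyConvexDomain X) {z : SympSpace n} (hz : z ∈ frontier X) :
    IsOuterUnitNormal X z (outerNormal X z) := by
  have h := (hX.existsUnique_normal hz).exists
  rw [outerNormal, dif_pos h]
  exact h.choose_spec

lemma IsStronglyConvexDomain.inward {n : ℕ} {X : Set (SympSpace n)}
    (hX : IsStronglyConvexDomain X) {z : SympSpace n} (hz : z ∈ frontier X) {v : SympSpace n}
    (hv : inner ℝ (outerNormal X z) v < 0) : ∀ᶠ t : ℝ in 𝓝[>] 0, z + t • v ∈ X := by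
  obtain ⟨U, ρ, hU, hzU, hρ, hXU, hd, -⟩ := hX.boundary z hz
  exact (fderiv_eq (hX.outerNormal_spec hz) hU hzU
    ((hρ.contDiffAt (hU.mem_nhds hzU)).differentiableAt (by simp))
    ((hX.defining hz hU hρ.continuousOn hXU).2.2 hzU) hXU hd).2 v hv

/-- The closed domain meets a supporting hyperplane in one point only. -/
lemma IsStronglyConvexDomain.strict {n : ℕ} {X : Set (SympSpace n)}
    (hX : IsStronglyConvexDomain X) {z w : SympSpace n} (hz : z ∈ frontier X)
    (hw : w ∈ closure X) (hne : w ≠ z) : inner ℝ (outerNormal X z) (w - z) < 0 := by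
  obtain ⟨U, ρ, hU, hzU, hρ, hXU, hd, hpos⟩ := hX.boundary z hz
  have hN := hX.outerNormal_spec hz
  have hsm := hρ.contDiffAt (hU.mem_nhds hzU)
  obtain ⟨hle, hge, hz0⟩ := hX.defining hz hU hρ.continuousOn hXU
  have hin := (fderiv_eq hN hU hzU (hsm.differentiableAt (by simp)) (hz0 hzU) hXU hd).1
  have hle0 : ∀ u ∈ closure X, inner ℝ (outerNormal X z) (u - z) ≤ 0 := by
    intro u hu
    refine closure_minimal (t := {u | inner ℝ (outerNormal X z) (u - z) ≤ 0}) hN.2 ?_ hu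
    exact isClosed_le (by fun_prop) continuous_const
  refine lt_of_le_of_ne (hle0 w hw) fun h0 => ?_
  set v := w - z with hv
  have hv0 : v ≠ 0 := sub_ne_zero.mpr hne
  have hdv : fderiv ℝ ρ z v = 0 := by rw [hin, h0, mul_zero]
  have hH := hpos v hv0 hdv
  have hline : ∀ t : ℝ, HasDerivAt (fun t : ℝ => z + t • v) v t := by
    intro t
    simpa using ((hasDerivAt_id t).smul_const v).const_add z
  -- points of the segment from `z` to `w` lie in the closure but not in `X`
  have hseg : ∀ t : ℝ, 0 < t → t < 1 → z + t • v ∈ U → ρ (z + t • v) = 0 := by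
    intro t ht0 ht1 htU
    have hcl : z + t • v ∈ closure X := by
      have := hX.convex.closure hz.1 hw (sub_nonneg.mpr ht1.le) ht0.le (by ring)
      convert this using 1
      rw [hv, smul_sub, sub_smul, one_smul]
      abel
    refine le_antisymm (hle _ hcl htU) (hge _ (fun hmem => ?_) htU)
    have hmem' : ∀ᶠ s : ℝ in 𝓝[>] 0, z + t • v + s • outerNormal X z ∈ X := by
      apply nhdsWithin_le_nhds
      have hc : ContinuousAt (fun s : ℝ => z + t • v + s • outerNormal X z) 0 := by fun_prop
      apply hc.eventually_mem
      simpa using hX.isOpen.mem_nhds hmem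
    obtain ⟨s, hs, hs0⟩ := (hmem'.and self_mem_nhdsWithin).exists
    have hs0' : (0 : ℝ) < s := hs0
    have h3 := hN.2 _ hs
    rw [add_assoc, add_sub_cancel_left, inner_add_right, inner_smul_right, inner_smul_right, h0,
      real_inner_self_eq_norm_sq, hN.1] at h3
    linarith
  have hUt : ∀ᶠ t : ℝ in 𝓝 0, z + t • v ∈ U := by
    apply (hline 0).continuousAt.eventually_mem
    simpa using hU.mem_nhds hzU
  have hgood : ∀ᶠ t : ℝ in 𝓝[>] 0, 0 < t ∧ t < 1 ∧ z + t • v ∈ U := by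
    filter_upwards [self_mem_nhdsWithin, nhdsWithin_le_nhds (Iio_mem_nhds (zero_lt_one)),
      nhdsWithin_le_nhds hUt] with t h1 h2 h3
    exact ⟨h1, h2, h3⟩
  have hzero : ∀ᶠ t : ℝ in 𝓝[>] 0, fderiv ℝ ρ (z + t • v) v = 0 := by
    filter_upwards [hgood] with t ht
    have hdt : HasDerivAt (fun t : ℝ => ρ (z + t • v)) (fderiv ℝ ρ (z + t • v) v) t :=
      (((hρ.contDiffAt (hU.mem_nhds ht.2.2)).differentiableAt
        (by simp)).hasFDerivAt).comp_hasDerivAt t (hline t)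
    have hloc : (fun t : ℝ => ρ (z + t • v)) =ᶠ[𝓝 t] fun _ => (0 : ℝ) := by
      filter_upwards [Ioo_mem_nhds ht.1 ht.2.1,
        (hline t).continuousAt.eventually_mem (hU.mem_nhds ht.2.2)] with s hs hsU
      exact hseg s hs.1 hs.2 hsU
    exact hdt.unique ((hasDerivAt_const t (0 : ℝ)).congr_of_eventuallyEq hloc)
  have hdd : HasDerivAt (fun t : ℝ => fderiv ℝ ρ (z + t • v) v)
      (fderiv ℝ (fderiv ℝ ρ) z v v) 0 := by
    have h1 : HasFDerivAt (fderiv ℝ ρ) (fderiv ℝ (fderiv ℝ ρ) z) (z + (0 : ℝ) • v) := by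
      have : DifferentiableAt ℝ (fderiv ℝ ρ) z :=
        (hsm.fderiv_right (m := 1) (by norm_cast)).differentiableAt (by simp)
      simpa using this.hasFDerivAt
    exact ((ContinuousLinearMap.apply ℝ ℝ v).hasFDerivAt).comp_hasDerivAt (0 : ℝ)
      (h1.comp_hasDerivAt (0 : ℝ) (hline 0))
  have hz' : HasDerivWithinAt (fun t : ℝ => fderiv ℝ ρ (z + t • v) v) 0 (Ioi 0) 0 :=
    (hasDerivWithinAt_const (0 : ℝ) (Ioi 0) (0 : ℝ)).congr_of_eventuallyEq hzero (by simpa using hdv)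
  have := (uniqueDiffWithinAt_Ioi (0 : ℝ)).eq_deriv _ hdd.hasDerivWithinAt hz'
  linarith

lemma sympForm_swap {n : ℕ} (u v : SympSpace n) : sympForm u v = -sympForm v u := by
  simp [sympForm, stdJ, PiLp.inner_apply, Matrix.toEuclideanLin, Matrix.fromBlocks_mulVec,
    Fintype.sum_sum_type, Matrix.toLpLin_apply, Matrix.neg_mulVec, Function.comp_def, mul_comm]

/-- The phase space of the symplectic billiard: the pairs `(x, y)` of boundary points with
`ω(N_x, N_y) ≠ 0`, that is, those for which the line through `x` in the characteristic direction
`J N_y` is transverse to the boundary at `x` and so meets the boundary in a second point. It carries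
the topology induced from `ℝ²ⁿ × ℝ²ⁿ` and is an open subset of `∂X × ∂X`. -/
def phaseSpace {n : ℕ} (X : Set (SympSpace n)) : Set (SympSpace n × SympSpace n) :=
  {p | p.1 ∈ frontier X ∧ p.2 ∈ frontier X ∧
    sympForm (outerNormal X p.1) (outerNormal X p.2) ≠ 0}

/-- The reflection law: the ray `xy` is reflected to the ray `yz`, where `z ≠ x` is the boundary
point such that `xz` is parallel to the characteristic direction `J N_y` at `y`. -/
def Reflects {n : ℕ} (X : Set (SympSpace n)) (x y z : SympSpace n) : Prop :=
  z ∈ frontier X ∧ z ≠ x ∧ ∃ t : ℝ, z - x = t • charDir X y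

/-- The reflected ray exists and is unique. -/
lemma IsStronglyConvexDomain.existsUnique_reflects {n : ℕ} {X : Set (SympSpace n)}
    (hX : IsStronglyConvexDomain X) {p : SympSpace n × SympSpace n} (hp : p ∈ phaseSpace X) :
    ∃! z, Reflects X p.1 p.2 z := by
  obtain ⟨x, y⟩ := p
  obtain ⟨hx, hy, hω⟩ := hp
  simp only at hx hy hω
  have hω' : inner ℝ (outerNormal X x) (charDir X y) ≠ 0 := hω
  apply existsUnique_of_exists_of_unique
  · obtain ⟨σ, hσ⟩ : ∃ σ : ℝ, inner ℝ (outerNormal X x) (σ • charDir X y) < 0 := by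
      refine ⟨-inner ℝ (outerNormal X x) (charDir X y), ?_⟩
      rw [inner_smul_right]
      nlinarith [mul_self_pos.mpr hω']
    set d := σ • charDir X y with hd
    have hd0 : d ≠ 0 := by
      intro h
      rw [h] at hσ
      simp at hσ
    obtain ⟨t₀, ht₀, hpos⟩ := ((hX.inward hx hσ).and self_mem_nhdsWithin).exists
    have hpos' : (0 : ℝ) < t₀ := hpos
    obtain ⟨R, hR⟩ := hX.isBounded.subset_closedBall x
    obtain ⟨t₁, ht₁, ht₁R⟩ : ∃ t₁ : ℝ, t₀ ≤ t₁ ∧ x + t₁ • d ∉ X := by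
      refine ⟨max t₀ ((R + 1) / ‖d‖), le_max_left _ _, fun hmem => ?_⟩
      have hb := hR hmem
      rw [mem_closedBall_iff_norm, add_sub_cancel_left, norm_smul, Real.norm_eq_abs] at hb
      have h1 : (R + 1) / ‖d‖ ≤ |max t₀ ((R + 1) / ‖d‖)| :=
        (le_max_right _ _).trans (le_abs_self _)
      rw [div_le_iff₀ (norm_pos_iff.mpr hd0)] at h1
      linarith
    have hpre : IsPreconnected ((fun t : ℝ => x + t • d) '' Icc t₀ t₁) :=
      isPreconnected_Icc.image _ (by fun_prop)
    obtain ⟨t, ht, htf⟩ : ∃ t ∈ Icc t₀ t₁, x + t • d ∈ frontier X := by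
      by_contra! hcon
      have hcl : ∀ t ∈ Icc t₀ t₁, x + t • d ∉ X → x + t • d ∉ closure X := fun t ht hnX hc =>
        hcon t ht ⟨hc, by rwa [hX.isOpen.interior_eq]⟩
      obtain ⟨u, -, hu1, hu2⟩ := hpre X (closure X)ᶜ hX.isOpen isClosed_closure.isOpen_compl
        (by
          rintro _ ⟨t, ht, rfl⟩
          by_cases h : x + t • d ∈ X
          · exact Or.inl h
          · exact Or.inr (hcl t ht h))
        ⟨_, ⟨t₀, ⟨le_rfl, ht₁⟩, rfl⟩, ht₀⟩
        ⟨_, ⟨t₁, ⟨ht₁, le_rfl⟩, rfl⟩, hcl t₁ ⟨ht₁, le_rfl⟩ ht₁R⟩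
      exact hu2 (subset_closure hu1)
    have htp : 0 < t := hpos'.trans_le ht.1
    refine ⟨x + t • d, htf, ?_, t * σ, ?_⟩
    · simp [htp.ne', hd0]
    · rw [add_sub_cancel_left, hd, smul_smul]
  · have aux : ∀ z z' : SympSpace n, ∀ s s' : ℝ, z ∈ frontier X → z' ∈ frontier X → z ≠ x →
        z' ≠ x → z - x = s • charDir X y → z' - x = s' • charDir X y → |s| < |s'| → False := by
      intro z z' s s' hz hz' hzx hz'x hs hs' hlt
      have h1 := hX.strict hx hz.1 hzx
      have h2 := hX.strict hx hz'.1 hz'x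
      rw [hs, inner_smul_right] at h1
      rw [hs', inner_smul_right] at h2
      have hzz : z' - z = (s' - s) • charDir X y := by
        rw [sub_smul, ← hs, ← hs']
        abel
      have hne : z' ≠ z := by
        intro h
        rw [h, sub_self] at hzz
        rcases smul_eq_zero.mp hzz.symm with h3 | h3
        · rw [sub_eq_zero.mp h3] at hlt
          exact lt_irrefl _ hlt
        · rw [h3] at hω'
          simp at hω'
      have h3 := hX.strict hz hx.1 hzx.symm
      have h4 := hX.strict hz hz'.1 hne
      rw [← neg_sub, hs, inner_neg_right, inner_smul_right] at h3
      rw [hzz, inner_smul_right] at h4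
      set a := inner ℝ (outerNormal X x) (charDir X y)
      set b := inner ℝ (outerNormal X z) (charDir X y)
      rcases lt_or_gt_of_ne hω' with ha | ha
      · have hs0 : 0 < s := by
          by_contra hcon
          nlinarith [mul_nonneg_of_nonpos_of_nonpos (not_lt.mp hcon) ha.le]
        have hs0' : 0 < s' := by
          by_contra hcon
          nlinarith [mul_nonneg_of_nonpos_of_nonpos (not_lt.mp hcon) ha.le]
        rw [abs_of_pos hs0, abs_of_pos hs0'] at hlt
        have hb : 0 < b := by
          by_contra hcon
          nlinarith [mul_nonneg hs0.le (neg_nonneg.mpr (not_lt.mp hcon))]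
        nlinarith [mul_pos (sub_pos.mpr hlt) hb]
      · have hs0 : s < 0 := by
          by_contra hcon
          nlinarith [mul_nonneg (not_lt.mp hcon) ha.le]
        have hs0' : s' < 0 := by
          by_contra hcon
          nlinarith [mul_nonneg (not_lt.mp hcon) ha.le]
        rw [abs_of_neg hs0, abs_of_neg hs0'] at hlt
        have hb : b < 0 := by
          by_contra hcon
          nlinarith [mul_nonneg (neg_nonneg.mpr hs0.le) (not_lt.mp hcon)]
        nlinarith [mul_pos (sub_pos.mpr hlt) (neg_pos.mpr hb)]
    rintro z z' ⟨hz, hzx, s, hs⟩ ⟨hz', hz'x, s', hs'⟩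
    rcases lt_trichotomy |s| |s'| with h | h | h
    · exact (aux z z' s s' hz hz' hzx hz'x hs hs' h).elim
    · have h1 := hX.strict hx hz.1 hzx
      have h2 := hX.strict hx hz'.1 hz'x
      rw [hs, inner_smul_right] at h1
      rw [hs', inner_smul_right] at h2
      rcases abs_eq_abs.mp h with h3 | h3
      · rw [h3, ← hs'] at hs
        exact sub_left_injective hs
      · rw [h3] at h1
        linarith
    · exact (aux z' z s' s hz' hz hz'x hzx hs' hs h).elim

/-- The reflected ray belongs to the phase space. -/
lemma IsStronglyConvexDomain.reflects_mem {n : ℕ} {X : Set (SympSpace n)}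
    (hX : IsStronglyConvexDomain X) {p : SympSpace n × SympSpace n} (hp : p ∈ phaseSpace X)
    {z : SympSpace n} (hz : Reflects X p.1 p.2 z) : (p.2, z) ∈ phaseSpace X := by
  obtain ⟨hzf, hzx, t, ht⟩ := hz
  refine ⟨hp.2.1, hzf, ?_⟩
  simp only
  rw [sympForm_swap, neg_ne_zero]
  intro h
  have h' : inner ℝ (outerNormal X z) (charDir X p.2) = 0 := h
  have h1 := hX.strict hzf hp.1.1 hzx.symm
  rw [← neg_sub, ht, inner_neg_right, inner_smul_right, h', mul_zero, neg_zero] at h1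
  exact lt_irrefl _ h1

/-- The symplectic billiard map `(x, y) ↦ (y, z)` of the phase space. -/
noncomputable def billiardMap {n : ℕ} {X : Set (SympSpace n)} (hX : IsStronglyConvexDomain X)
    (p : phaseSpace X) : phaseSpace X :=
  ⟨(p.1.2, (hX.existsUnique_reflects p.2).choose),
    hX.reflects_mem p.2 (hX.existsUnique_reflects p.2).choose_spec.1⟩

/-- The `k`-periodic points of the symplectic billiard map: the points of its phase space that lie
on `k`-periodic orbits. -/
def periodicPoints {n : ℕ} {X : Set (SympSpace n)} (hX : IsStronglyConvexDomain X) (k : ℕ) :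
    Set (phaseSpace X) :=
  Function.ptsOfPeriod (billiardMap hX) k

end SymplecticBilliard

/-!
For a fixed boundary point `x`, only finitely many `y` make `(x, y)` a periodic point of period `3`
or `4`. This suffices: the outer normal is continuous along `∂X`, so every `y'` on `∂X` close to
`y` gives a pair `(x, y')` of the phase space, and there are infinitely many such `y'`, since every
small sphere around `y` is connected and meets both `X` and the exterior of `X`, hence meets `∂X`.

*Period four.* Along a `4`-periodic orbit `x, y, z, w` the normals at `x` and `z` are both parallel
to `J (w - y)`, so `N_z = -N_x` and `z` is determined by `x`. As `z - x` is parallel to `J N_y`, the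
normal `N_y` is determined up to its sign, and with it `y`.

*Period three.* Along a `3`-periodic orbit `x, y, z` each side of the triangle is a multiple of
`J N` for the normal `N` at the opposite vertex, and for a cyclic orientation of the sides the three
factors have the same sign, opposite to that of the area `ω(y - x, z - x)`. Given two such triangles `x, y, z` and `x, y', z'` with areas of the same sign,
strict convexity in the form `⟪N_y, y' - y⟫ < 0`, together with its analogues at `y'`, `z`, `z'`,
becomes a system of four inequalities between values of `ω`. As `y - z` and `y' - z'` are both
multiples `b e`, `b' e` of `e = J N_x`, these involve only `b`, `b'`, the heights `ω(y - x, e)`,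
`ω(y' - x, e)` and `ω(y - x, y' - x)`, and are contradictory. So there is at most one `y` for each
sign of the area.
-/

namespace SymplecticBilliard

open Set Filter Topology

variable {n : ℕ}

/-! ### The symplectic form -/

lemma stdJ_stdJ (v : SympSpace n) : stdJ n (stdJ n v) = -v := by
  ext i
  rcases i with i | i <;>
  simp [stdJ, Matrix.toEuclideanLin, Matrix.fromBlocks_mulVec, Matrix.toLpLin_apply,
    Matrix.neg_mulVec, Function.comp_def]

lemma stdJ_injective : Function.Injective (stdJ n) := fun u v h => by
  have := congrArg (stdJ n) h
  rwa [stdJ_stdJ, stdJ_stdJ, neg_inj] at this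

lemma sympForm_sub_left (u v w : SympSpace n) :
    sympForm (u - v) w = sympForm u w - sympForm v w := by
  simp [sympForm, inner_sub_left]

lemma sympForm_sub_right (u v w : SympSpace n) :
    sympForm u (v - w) = sympForm u v - sympForm u w := by
  simp [sympForm, inner_sub_right]

lemma sympForm_smul_right (t : ℝ) (u v : SympSpace n) :
    sympForm u (t • v) = t * sympForm u v := by
  simp [sympForm, inner_smul_right]

lemma sympForm_self (u : SympSpace n) : sympForm u u = 0 := by
  linarith [sympForm_swap u u]

lemma sympForm_charDir (X : Set (SympSpace n)) (u y : SympSpace n) :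
    sympForm u (charDir X y) = -inner ℝ (outerNormal X y) u := by
  rw [sympForm, charDir, stdJ_stdJ, inner_neg_right, real_inner_comm]

/-! ### Outer normals -/

variable {X : Set (SympSpace n)}

lemma IsStronglyConvexDomain.norm_outerNormal (hX : IsStronglyConvexDomain X) {z : SympSpace n}
    (hz : z ∈ frontier X) : ‖outerNormal X z‖ = 1 :=
  (hX.outerNormal_spec hz).1

lemma IsStronglyConvexDomain.injOn_outerNormal (hX : IsStronglyConvexDomain X) :
    InjOn (outerNormal X) (frontier X) := by
  intro y hy z hz h
  by_contra hne
  have h1 := hX.strict hy hz.1 (Ne.symm hne)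
  have h2 := hX.strict hz hy.1 hne
  rw [← h, ← neg_sub z y, inner_neg_right] at h2
  linarith

lemma IsStronglyConvexDomain.continuousOn_outerNormal (hX : IsStronglyConvexDomain X) :
    ContinuousOn (outerNormal X) (frontier X) := by
  intro y hy
  refine (isCompact_sphere (0 : SympSpace n) 1).tendsto_nhds_of_unique_mapClusterPt ?_ ?_
  · filter_upwards [self_mem_nhdsWithin] with z hz
    simpa using hX.norm_outerNormal hz
  -- a cluster value of the normals at nearby points is an outer unit normal at `y`
  · intro N hN hcl
    obtain ⟨F, hF, hlim⟩ := mapClusterPt_iff_ultrafilter.mp hcl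
    refine (hX.existsUnique_normal hy).unique ⟨by simpa using hN, fun w hw => ?_⟩
      (hX.outerNormal_spec hy)
    have hid : Tendsto (fun z : SympSpace n => z) F (𝓝 y) :=
      tendsto_id'.mpr (hF.trans nhdsWithin_le_nhds)
    refine le_of_tendsto (hlim.inner (tendsto_const_nhds.sub hid)) ?_
    filter_upwards [hF self_mem_nhdsWithin] with z hz
    exact (hX.outerNormal_spec hz).2 w hw

/-! ### The boundary near one of its points -/

/-- Every small sphere around a boundary point meets the boundary, being connected and meeting both
the convex domain and its exterior. -/
lemma IsStronglyConvexDomain.infinite_frontier_inter (hX : IsStronglyConvexDomain X)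
    (hn : n ≠ 0) {y : SympSpace n} (hy : y ∈ frontier X) {V : Set (SympSpace n)}
    (hV : V ∈ 𝓝 y) : (frontier X ∩ V).Infinite := by
  have hrank : 1 < Module.rank ℝ (SympSpace n) := by
    apply Module.one_lt_rank_of_one_lt_finrank
    simp
    omega
  obtain ⟨w, hw⟩ := hX.nonempty
  have hyX : y ∉ X := by
    have := hy.2
    rwa [hX.isOpen.interior_eq] at this
  have hwy : 0 < ‖w - y‖ := norm_pos_iff.mpr (sub_ne_zero.mpr fun h => hyX (h ▸ hw))
  obtain ⟨ε, hε, hball⟩ := Metric.mem_nhds_iff.mp hV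
  have hsub : Ioo 0 (min ε ‖w - y‖) ⊆ (fun u => dist u y) '' (frontier X ∩ V) := by
    rintro r ⟨hr0, hr⟩
    obtain ⟨hrε, hrw⟩ := lt_min_iff.mp hr
    suffices h : ∃ u ∈ Metric.sphere y r, u ∈ frontier X by
      obtain ⟨u, hu, huf⟩ := h
      exact ⟨u, ⟨huf, hball (by rw [Metric.mem_ball, Metric.mem_sphere.mp hu]; exact hrε)⟩, hu⟩
    by_contra! hcon
    obtain ⟨u, -, hu1, hu2⟩ := (isPreconnected_sphere hrank y r) X (closure X)ᶜ hX.isOpen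
      isClosed_closure.isOpen_compl
      (by
        intro u hu
        by_cases h : u ∈ X
        · exact Or.inl h
        · exact Or.inr fun hc => hcon u hu ⟨hc, by rwa [hX.isOpen.interior_eq]⟩)
      (by
        refine ⟨y + (r / ‖w - y‖) • (w - y), ?_, ?_⟩
        · rw [mem_sphere_iff_norm, add_sub_cancel_left, norm_smul, norm_div, norm_norm,
            div_mul_cancel₀ _ hwy.ne', Real.norm_of_nonneg hr0.le]
        · have hwi : w ∈ interior X := by rwa [hX.isOpen.interior_eq]
          have := hX.convex.add_smul_sub_mem_interior' hy.1 hwi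
            (t := r / ‖w - y‖) ⟨by positivity, (div_le_one hwy).mpr hrw.le⟩
          exact interior_subset this)
      (by
        refine ⟨y + r • outerNormal X y, ?_, fun hc => ?_⟩
        · rw [mem_sphere_iff_norm, add_sub_cancel_left, norm_smul, hX.norm_outerNormal hy,
            mul_one, Real.norm_of_nonneg hr0.le]
        · have hne : y + r • outerNormal X y ≠ y := by
            have h0 : outerNormal X y ≠ 0 := fun h => by simpa [h] using hX.norm_outerNormal hy
            simp [hr0.ne', h0]
          have := hX.strict hy hc hne
          rw [add_sub_cancel_left, inner_smul_right, real_inner_self_eq_norm_sq,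
            hX.norm_outerNormal hy] at this
          linarith)
    exact hu2 (subset_closure hu1)
  exact ((Ioo_infinite (lt_min hε hwy)).mono hsub).of_image _

/-! ### Orbits of period three -/

/-- If `z - x` is parallel to `J N_y`, then `v ↦ ω(y - v, z - x)` has the same sign on all of the
closed domain except `y`: it is a multiple of `⟪N_y, v - y⟫`. -/
lemma IsStronglyConvexDomain.sympForm_mul_pos (hX : IsStronglyConvexDomain X)
    {x y z v : SympSpace n} (hx : x ∈ frontier X) (hy : y ∈ frontier X) (hv : v ∈ frontier X)
    (hxy : x ≠ y) (hvy : v ≠ y) (h : Reflects X x y z) :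
    0 < sympForm (y - x) (z - x) * sympForm (y - v) (z - x) := by
  obtain ⟨-, hzx, t, ht⟩ := h
  have ht0 : t ≠ 0 := by
    rintro rfl
    exact hzx (sub_eq_zero.mp (by simpa using ht))
  have h1 := hX.strict hy hx.1 hxy
  have h2 := hX.strict hy hv.1 hvy
  have key : ∀ u, sympForm (y - u) (z - x) = t * inner ℝ (outerNormal X y) (u - y) := by
    intro u
    rw [ht, sympForm_smul_right, sympForm_charDir, ← inner_neg_right, neg_sub]
  rw [key, key]
  have := mul_pos (mul_self_pos.mpr ht0) (mul_pos_of_neg_of_neg h1 h2)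
  linarith

/-- The values of `ω` on two triangles with a common vertex and two parallel sides `b e`, `b' e`,
of heights `h` and `h'`, cannot satisfy the inequalities that strict convexity would impose. -/
lemma false_of_height_inequalities {b b' h h' s : ℝ} (hb : 0 < b) (hb' : 0 < b') (hh : 0 < h)
    (hh' : 0 < h') (h1 : s < b * (h - h')) (h2 : b' * (h - h') < s) (h3 : (b' - b) * h ≤ s)
    (h4 : s ≤ (b' - b) * h') : False := by
  rcases le_or_gt h' h with hle | hlt
  · have hs : 0 < (b' - b) * h' := (mul_nonneg hb'.le (sub_nonneg.mpr hle)).trans_lt (h2.trans_le h4)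
    have hbb := (pos_iff_pos_of_mul_pos hs).mpr hh'
    nlinarith [mul_nonneg hbb.le (sub_nonneg.mpr hle)]
  · have hs : s < 0 := h1.trans (mul_neg_of_pos_of_neg hb (sub_neg.mpr hlt))
    have hbb : b' < b := by
      by_contra hcon
      nlinarith [mul_nonneg (sub_nonneg.mpr (not_lt.mp hcon)) hh.le]
    nlinarith [mul_pos (sub_pos.mpr hbb) (sub_pos.mpr hlt)]

/-- `x, y, z` is an orbit of period three of the symplectic billiard. -/
structure IsThreeOrbit (X : Set (SympSpace n)) (x y z : SympSpace n) : Prop where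
  reflects_fst : Reflects X x y z
  reflects_snd : Reflects X y z x
  reflects_trd : Reflects X z x y

namespace IsThreeOrbit

lemma sympForm_ne_zero (hX : IsStronglyConvexDomain X) {x y z : SympSpace n}
    (h : IsThreeOrbit X x y z) : sympForm (y - x) (z - x) ≠ 0 := by
  have := hX.sympForm_mul_pos h.reflects_snd.1 h.reflects_trd.1 h.reflects_snd.1
    h.reflects_snd.2.1 h.reflects_snd.2.1 h.reflects_fst
  exact fun h0 => by simp [h0] at this

/-- Two orbits of period three that start at the same point and have areas of the same sign have
the same second point. -/
lemma eq_of_sympForm_mul_pos (hX : IsStronglyConvexDomain X) {x y z y' z' : SympSpace n}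
    (h : IsThreeOrbit X x y z) (h' : IsThreeOrbit X x y' z')
    (hpos : 0 < sympForm (y - x) (z - x) * sympForm (y' - x) (z' - x)) : y = y' := by
  by_contra hne
  have hx := h.reflects_snd.1
  have hy := h.reflects_trd.1
  have hz := h.reflects_fst.1
  have hy' := h'.reflects_trd.1
  have hz' := h'.reflects_fst.1
  have hxy := h.reflects_snd.2.1
  have hxy' := h'.reflects_snd.2.1
  have i1 := hX.sympForm_mul_pos hx hy hy' hxy (Ne.symm hne) h.reflects_fst
  have i2 := hX.sympForm_mul_pos hx hy' hy hxy' hne h'.reflects_fst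
  have i3 : 0 ≤ sympForm (z - y) (x - y) * sympForm (z - z') (x - y) := by
    rcases eq_or_ne z' z with hzz | hzz
    · simp [hzz, sympForm]
    · exact (hX.sympForm_mul_pos hy hz hz' h.reflects_trd.2.1 hzz h.reflects_snd).le
  have i4 : 0 ≤ sympForm (z' - y') (x - y') * sympForm (z' - z) (x - y') := by
    rcases eq_or_ne z z' with hzz | hzz
    · simp [hzz, sympForm]
    · exact (hX.sympForm_mul_pos hy' hz' hz h'.reflects_trd.2.1 hzz h'.reflects_snd).le
  obtain ⟨b, hb⟩ := h.reflects_trd.2.2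
  obtain ⟨b', hb'⟩ := h'.reflects_trd.2.2
  have hh : 0 < sympForm (y - x) (charDir X x) := by
    rw [sympForm_charDir]
    linarith [hX.strict hx hy.1 hxy.symm]
  have hh' : 0 < sympForm (y' - x) (charDir X x) := by
    rw [sympForm_charDir]
    linarith [hX.strict hx hy'.1 hxy'.symm]
  set e := charDir X x
  set p := y - x with hp
  set p' := y' - x with hp'
  have e1 : z - x = p - b • e := by rw [← hb, hp]; abel
  have e2 : z' - x = p' - b' • e := by rw [← hb', hp']; abel
  have e3 : y - y' = p - p' := by rw [hp, hp']; abel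
  have e4 : y' - y = p' - p := by rw [hp, hp']; abel
  have e5 : x - y = 0 - p := by rw [hp]; abel
  have e6 : x - y' = 0 - p' := by rw [hp']; abel
  have e7 : z - y = 0 - b • e := by rw [← hb]; abel
  have e8 : z' - y' = 0 - b' • e := by rw [← hb']; abel
  have e9 : z - z' = (p - b • e) - (p' - b' • e) := by rw [← e1, ← e2]; abel
  have e10 : z' - z = (p' - b' • e) - (p - b • e) := by rw [← e1, ← e2]; abel
  have z1 : ∀ u : SympSpace n, sympForm u 0 = 0 := fun u => by simp [sympForm]
  have z2 : ∀ u : SympSpace n, sympForm 0 u = 0 := fun u => by simp [sympForm]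
  rw [e1] at i1 hpos
  rw [e2] at i2 hpos
  rw [e3] at i1
  rw [e4] at i2
  rw [e7, e5, e9] at i3
  rw [e8, e6, e10] at i4
  simp only [sympForm_sub_left, sympForm_sub_right, sympForm_smul_right, sympForm_self, z1, z2,
    sympForm_swap p' p, sympForm_swap (_ • e) _] at i1 i2 i3 i4 hpos
  set k := sympForm p e
  set k' := sympForm p' e
  set s := sympForm p p'
  have hbb : 0 < b * b' := by
    refine (pos_iff_pos_of_mul_pos (b := k * k') ?_).mpr (mul_pos hh hh')
    linarith
  have j1 : 0 < b * (b * (k - k') - s) :=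
    (pos_iff_pos_of_mul_pos (b := k) (by linarith)).mpr hh
  have j2 : 0 < b' * (s - b' * (k - k')) :=
    (pos_iff_pos_of_mul_pos (b := k') (by linarith)).mpr hh'
  have j3 : 0 ≤ b * (s - (b' - b) * k) := nonneg_of_mul_nonneg_left (b := k) (by linarith) hh
  have j4 : 0 ≤ b' * ((b' - b) * k' - s) := nonneg_of_mul_nonneg_left (b := k') (by linarith) hh'
  rcases lt_or_gt_of_ne (show b ≠ 0 by rintro rfl; simp at hbb) with hb0 | hb0
  -- a negative `b` means a positive area; changing the sign of `ω` reduces to the other case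
  · have hb0' : b' < 0 := (neg_iff_neg_of_mul_pos hbb).mp hb0
    exact false_of_height_inequalities (s := -s) (neg_pos.mpr hb0) (neg_pos.mpr hb0') hh hh'
      (by linarith [neg_of_mul_pos_right j1 hb0.le]) (by linarith [neg_of_mul_pos_right j2 hb0'.le])
      (by linarith [nonpos_of_mul_nonneg_right j3 hb0])
      (by linarith [nonpos_of_mul_nonneg_right j4 hb0'])
  · have hb0' : 0 < b' := (pos_iff_pos_of_mul_pos hbb).mp hb0
    exact false_of_height_inequalities hb0 hb0' hh hh'
      (by linarith [pos_of_mul_pos_right j1 hb0.le]) (by linarith [pos_of_mul_pos_right j2 hb0'.le])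
      (by linarith [nonneg_of_mul_nonneg_right j3 hb0])
      (by linarith [nonneg_of_mul_nonneg_right j4 hb0'])

end IsThreeOrbit

/-! ### Orbits of period four -/

lemma IsStronglyConvexDomain.outerNormal_eq_or_eq_neg (hX : IsStronglyConvexDomain X)
    {y z u : SympSpace n} (hy : y ∈ frontier X) (hz : z ∈ frontier X) (hu : u ≠ 0) {s t : ℝ}
    (hs : u = s • charDir X y) (ht : u = t • charDir X z) :
    outerNormal X z = outerNormal X y ∨ outerNormal X z = -outerNormal X y := by
  have h : s • outerNormal X y = t • outerNormal X z := by
    apply stdJ_injective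
    rw [map_smul, map_smul]
    exact hs.symm.trans ht
  have ht0 : t ≠ 0 := by
    rintro rfl
    simp [hu] at ht
  have hn := congrArg norm h
  rw [norm_smul, norm_smul, hX.norm_outerNormal hy, hX.norm_outerNormal hz, mul_one, mul_one,
    Real.norm_eq_abs, Real.norm_eq_abs] at hn
  rcases abs_eq_abs.mp hn with h1 | h1
  · exact Or.inl (smul_right_injective _ ht0 (by simp only; rw [← h, h1]))
  · exact Or.inr (smul_right_injective _ ht0 (by simp only; rw [← h, h1, neg_smul, smul_neg]))

/-- `x, y, z, w` is an orbit of period four of the symplectic billiard. -/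
structure IsFourOrbit (X : Set (SympSpace n)) (x y z w : SympSpace n) : Prop where
  reflects_fst : Reflects X x y z
  reflects_snd : Reflects X y z w
  reflects_trd : Reflects X z w x
  reflects_fth : Reflects X w x y

namespace IsFourOrbit

lemma outerNormal_eq_neg (hX : IsStronglyConvexDomain X) {x y z w : SympSpace n}
    (h : IsFourOrbit X x y z w) : outerNormal X z = -outerNormal X x := by
  obtain ⟨-, hwy, s, hs⟩ := h.reflects_snd
  obtain ⟨-, -, t, ht⟩ := h.reflects_fth
  have hx := h.reflects_trd.1
  have hz := h.reflects_fst.1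
  refine (hX.outerNormal_eq_or_eq_neg hx hz (sub_ne_zero.mpr hwy) (s := -t) ?_ hs).resolve_left
    fun he => h.reflects_fst.2.1 (hX.injOn_outerNormal hz hx he)
  rw [neg_smul, ← ht, neg_sub]

lemma outerNormal_eq_or_eq_neg (hX : IsStronglyConvexDomain X) {x y z w y' z' w' : SympSpace n}
    (h : IsFourOrbit X x y z w) (h' : IsFourOrbit X x y' z' w') :
    outerNormal X y' = outerNormal X y ∨ outerNormal X y' = -outerNormal X y := by
  have hzz : z = z' := hX.injOn_outerNormal h.reflects_fst.1 h'.reflects_fst.1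
    ((h.outerNormal_eq_neg hX).trans (h'.outerNormal_eq_neg hX).symm)
  subst hzz
  obtain ⟨-, hzx, s, hs⟩ := h.reflects_fst
  obtain ⟨-, -, t, ht⟩ := h'.reflects_fst
  exact hX.outerNormal_eq_or_eq_neg h.reflects_fth.1 h'.reflects_fth.1 (sub_ne_zero.mpr hzx) hs ht

end IsFourOrbit

/-! ### Finiteness of the fibres -/

lemma IsStronglyConvexDomain.finite_threeOrbit (hX : IsStronglyConvexDomain X) (x : SympSpace n) :
    {y | ∃ z, IsThreeOrbit X x y z}.Finite := by
  have hpos : {y | ∃ z, IsThreeOrbit X x y z ∧ 0 < sympForm (y - x) (z - x)}.Subsingleton := by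
    rintro y ⟨z, h, hz⟩ y' ⟨z', h', hz'⟩
    exact h.eq_of_sympForm_mul_pos hX h' (mul_pos hz hz')
  have hneg : {y | ∃ z, IsThreeOrbit X x y z ∧ sympForm (y - x) (z - x) < 0}.Subsingleton := by
    rintro y ⟨z, h, hz⟩ y' ⟨z', h', hz'⟩
    exact h.eq_of_sympForm_mul_pos hX h' (mul_pos_of_neg_of_neg hz hz')
  refine (hpos.finite.union hneg.finite).subset ?_
  rintro y ⟨z, h⟩
  rcases lt_or_gt_of_ne (h.sympForm_ne_zero hX) with h0 | h0
  · exact Or.inr ⟨z, h, h0⟩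
  · exact Or.inl ⟨z, h, h0⟩

lemma IsStronglyConvexDomain.finite_fourOrbit (hX : IsStronglyConvexDomain X) (x : SympSpace n) :
    {y | ∃ z w, IsFourOrbit X x y z w}.Finite := by
  rcases eq_empty_or_nonempty {y | ∃ z w, IsFourOrbit X x y z w} with he | ⟨y, z, w, h⟩
  · rw [he]
    exact finite_empty
  · refine Set.Finite.of_finite_image (f := outerNormal X)
      ((toFinite {outerNormal X y, -outerNormal X y}).subset ?_)
      (hX.injOn_outerNormal.mono ?_)
    · rintro _ ⟨y', ⟨z', w', h'⟩, rfl⟩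
      exact h.outerNormal_eq_or_eq_neg hX h'
    · rintro y' ⟨z', w', h'⟩
      exact h'.reflects_fth.1

lemma billiardMap_fst (hX : IsStronglyConvexDomain X) (p : phaseSpace X) :
    (billiardMap hX p).1.1 = p.1.2 := rfl

lemma reflects_billiardMap (hX : IsStronglyConvexDomain X) (p : phaseSpace X) :
    Reflects X p.1.1 p.1.2 (billiardMap hX p).1.2 :=
  (hX.existsUnique_reflects p.2).choose_spec.1

lemma exists_isThreeOrbit (hX : IsStronglyConvexDomain X) {p : phaseSpace X}
    (hp : p ∈ periodicPoints hX 3) : ∃ z, IsThreeOrbit X p.1.1 p.1.2 z := by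
  have h : billiardMap hX (billiardMap hX (billiardMap hX p)) = p := hp
  have h1 := reflects_billiardMap hX p
  have h2 := reflects_billiardMap hX (billiardMap hX p)
  have h3 := reflects_billiardMap hX (billiardMap hX (billiardMap hX p))
  have hf := billiardMap_fst hX (billiardMap hX (billiardMap hX p))
  rw [h] at h3 hf
  rw [billiardMap_fst] at h2 h3
  rw [← hf] at h2 h3
  exact ⟨_, h1, h2, h3⟩

lemma exists_isFourOrbit (hX : IsStronglyConvexDomain X) {p : phaseSpace X}
    (hp : p ∈ periodicPoints hX 4) : ∃ z w, IsFourOrbit X p.1.1 p.1.2 z w := by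
  have h : billiardMap hX (billiardMap hX (billiardMap hX (billiardMap hX p))) = p := hp
  have h1 := reflects_billiardMap hX p
  have h2 := reflects_billiardMap hX (billiardMap hX p)
  have h3 := reflects_billiardMap hX (billiardMap hX (billiardMap hX p))
  have h4 := reflects_billiardMap hX (billiardMap hX (billiardMap hX (billiardMap hX p)))
  have hf := billiardMap_fst hX (billiardMap hX (billiardMap hX (billiardMap hX p)))
  rw [h] at h4 hf
  rw [billiardMap_fst] at h2 h3 h4
  rw [← hf] at h3 h4
  exact ⟨_, _, h1, h2, h3, h4⟩

/-! ### Emptiness of the interior -/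

/-- A set of pairs with finite fibres over the first component has empty interior in the phase
space. -/
lemma interior_eq_empty_of_finite_fibres (hX : IsStronglyConvexDomain X) {P : Set (phaseSpace X)}
    (hP : ∀ x, {y | ∃ h : (x, y) ∈ phaseSpace X, (⟨(x, y), h⟩ : phaseSpace X) ∈ P}.Finite) :
    interior P = ∅ := by
  rw [eq_empty_iff_forall_notMem]
  rintro ⟨⟨x, y⟩, hxy⟩ hmem
  obtain ⟨hx, hy, hω⟩ := hxy
  simp only at hx hy hω
  have hn : n ≠ 0 := by
    rintro rfl
    exact hω (by simp [sympForm, PiLp.inner_apply])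
  obtain ⟨W, hW, hWP⟩ := mem_nhds_subtype _ _ _ |>.mp (mem_interior_iff_mem_nhds.mp hmem)
  have hW' : ∀ᶠ y' in 𝓝[frontier X] y, (x, y') ∈ W :=
    nhdsWithin_le_nhds ((Continuous.prodMk_right x).continuousAt.eventually hW)
  have hω' : ∀ᶠ y' in 𝓝[frontier X] y, sympForm (outerNormal X x) (outerNormal X y') ≠ 0 := by
    have hc : Continuous fun v : SympSpace n => sympForm (outerNormal X x) v :=
      continuous_const.inner (stdJ n).continuous_of_finiteDimensional
    exact (hc.continuousAt.tendsto.comp (hX.continuousOn_outerNormal y hy)).eventually_ne hω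
  obtain ⟨V, hV, hVsub⟩ := mem_nhdsWithin_iff_exists_mem_nhds_inter.mp (hW'.and hω')
  refine hX.infinite_frontier_inter hn hy hV ((hP x).subset ?_)
  rintro y' ⟨hy', hyV⟩
  obtain ⟨h1, h2⟩ := hVsub ⟨hyV, hy'⟩
  exact ⟨⟨hx, hy', h2⟩, hWP h1⟩

end SymplecticBilliard

theorem theorem2 (n : ℕ) (X : Set (SymplecticBilliard.SympSpace n))
    (hX : SymplecticBilliard.IsStronglyConvexDomain X) :
    interior (SymplecticBilliard.periodicPoints hX 3) = ∅ ∧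
    interior (SymplecticBilliard.periodicPoints hX 4) = ∅ ∧
    interior (SymplecticBilliard.periodicPoints hX 3 ∪ SymplecticBilliard.periodicPoints hX 4)
      = ∅ := by
  have h : interior (SymplecticBilliard.periodicPoints hX 3 ∪
      SymplecticBilliard.periodicPoints hX 4) = ∅ := by
    refine SymplecticBilliard.interior_eq_empty_of_finite_fibres hX fun x =>
      ((hX.finite_threeOrbit x).union (hX.finite_fourOrbit x)).subset ?_
    rintro y ⟨hxy, hp | hp⟩
    · exact Or.inl (SymplecticBilliard.exists_isThreeOrbit hX hp)
    · exact Or.inr (SymplecticBilliard.exists_isFourOrbit hX hp)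
  exact ⟨Set.subset_eq_empty (interior_mono Set.subset_union_left) h,
    Set.subset_eq_empty (interior_mono Set.subset_union_right) h, h⟩
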